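/- Let $p,m,n,q$ be positive integers, let $A,C\in\mathbb{C}^{p\times m}$ and $B,D\in\mathbb{C}^{n\times q}$. For a positive integer $s$ and matrices $M,N$ of the same size $a\times b$, let $M_s(M,N)$ denote the $(s+1)a\times sb$ block-bidiagonal matrix with $s+1$ block rows and $s$ block columns whose $(j,j)$ blocks are $M$ and whose $(j+1,j)$ blocks are $N$ ($1\le j\le s$), all other blocks being zero: $$M_s(M,N)=\begin{bmatrix} M\\ N&M\\ &N&\ddots\\ &&\ddots&M\\ &&&N\end{bmatrix}.$$ A pencil $M-\lambda N$ is called regular if it is square and $\det(M-\lambda N)$ is not identically zero as a polynomial in $\lambda$. The eigenvalues of a regular $a\times a$ pencil $M-\lambda N$ are the roots in $\mathbb{C}$ of $\det(M-\lambda N)$, together with $\infty$ if the degree of $\det(M-\lambda N)$ is less than $a$. Theorem. The equation $AXB-CXD=E$ has exactly one solution $X\in\mathbb{C}^{m\times n}$ for every right-hand side $E\in\mathbb{C}^{p\times q}$ if and only if one of the following situations holds: 1. $p=m$, $q=n$, and the pencils $A-\lambda C$ and $D^\top-\lambda B^\top$ are regular and have no common eigenvalues (in $\mathbb{C}\cup\{\infty\}$);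 or 2. $p<m$, $n<q$, $s=\dfrac{p}{m-p}=\dfrac{n}{q-n}$ is a positive integer, and the matrices $M_s(A,C)$ and $M_s(B,D)$ (which are then square) are both invertible; or 3. $p>m$, $n>q$, $s=\dfrac{m}{p-m}=\dfrac{q}{n-q}$ is a positive integer, and the matrices $M_s(A^\top,C^\top)$ and $M_s(B^\top,D^\top)$ (which are then square) are both invertible. -/

import Mathlib

namespace GenSylvester

open Polynomial

/-- The matrix pencil `M - λ N`, as a matrix of polynomials in `λ`. -/
noncomputable def pencil {a b : ℕ} (M N : Matrix (Fin a) (Fin b) ℂ) :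
    Matrix (Fin a) (Fin b) ℂ[X] :=
  M.map Polynomial.C - (X : ℂ[X]) • N.map Polynomial.C

/-- The determinant, as a polynomial in `λ`, of a pencil with as many rows as columns. -/
noncomputable def pencilDet {a b : ℕ} (P : Matrix (Fin a) (Fin b) ℂ[X]) (h : a = b) : ℂ[X] :=
  (P.submatrix id (Fin.cast h)).det

/-- A pencil is regular if it is square and its determinant is not identically zero. -/
def IsRegularPencil {a b : ℕ} (P : Matrix (Fin a) (Fin b) ℂ[X]) : Prop :=
  ∃ h : a = b, pencilDet P h ≠ 0

/-- The set of eigenvalues in `ℂ ∪ {∞}` of a regular `a × a` pencil: the roots of its determinant,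
together with `∞` if the determinant has degree less than `a`. (Empty if the pencil is not
regular.) -/
def pencilSpectrum {a b : ℕ} (P : Matrix (Fin a) (Fin b) ℂ[X]) : Set (OnePoint ℂ) :=
  {μ | ∃ h : a = b, pencilDet P h ≠ 0 ∧
    ((∃ z : ℂ, μ = (z : OnePoint ℂ) ∧ (pencilDet P h).IsRoot z) ∨
      (μ = OnePoint.infty ∧ (pencilDet P h).degree < (a : WithBot ℕ)))}

/-- The block bidiagonal matrix with `s + 1` block rows and `s` block columns, whose `(j, j)` blocks
are `M`, whose `(j + 1, j)` blocks are `N`, and whose other blocks are zero. -/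
def blockBidiag {a b : ℕ} (s : ℕ) (M N : Matrix (Fin a) (Fin b) ℂ) :
    Matrix (Fin (s + 1) × Fin a) (Fin s × Fin b) ℂ :=
  Matrix.of fun i j =>
    if i.1 = j.1.castSucc then M i.2 j.2
    else if i.1 = j.1.succ then N i.2 j.2
    else 0

/-- A matrix whose rows and columns are indexed by possibly different finite types is square and
invertible: there are as many rows as columns, and there is a two-sided inverse. -/
def IsSquareInvertible {α β : Type} [Fintype α] [Fintype β] [DecidableEq α] [DecidableEq β]
    (M : Matrix α β ℂ) : Prop :=
  Fintype.card α = Fintype.card β ∧ ∃ N : Matrix β α ℂ, M * N = 1 ∧ N * M = 1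

end GenSylvester

/-!
The proof is elementary: it replaces the Kronecker canonical form by chains of vectors. A *kernel
chain* of length `L` of `(A, C)` is a sequence `f 0, …, f (L - 1)` with `A f₀ = 0`,
`A fₖ₊₁ + C fₖ = 0` and `C f_{L-1} = 0`, that is, a polynomial null vector of `A + λ C` of degree
less than `L`; such chains are the kernel of the block bidiagonal matrix
(`blockBidiag_mulVec_eq_zero_iff`).

*Necessity.* If `p < m`, or if the pencil is square and singular, nonzero chains exist; let `L + 1`
be their least length. The entries of a minimal chain `f` are linearly independent
(`NoKernelChain.eq_zero_of_sum_diagonal_eq_zero`), so a nonzero left null vector `y` of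
`blockBidiag L B D` yields the nonzero solution `∑ f_j y_{L-j}ᵀ` of `A X B = C X D`. Hence
uniqueness gives `(L + 1) n ≤ L q`, while minimality gives `L m ≤ (L + 1) p`. For square
coefficients the first inequality is absurd, so the pencil is regular. For `p < m`, the equality
`m n = p q` of dimensions turns both inequalities into equalities: `L = p / (m - p)`, and
`blockBidiag L A C` is square with trivial kernel
(`SylvesterBijective.exists_isSquareInvertible`). The operators of `(A, C; B, D)` and `(B, D; A, C)`
are adjoint for the trace pairing, so the same holds for `(B, D)`, and transposition reduces `p > m`
to `p < m`.

*Sufficiency for `p < m`.* If `A X B = C X D` and `u` is a chain of `(B, D)` of length `s + 1`, the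
vectors `X B u_j` form a chain of `(C, A)` of length `s`, hence vanish. By independence and a
dimension count these chains fill `ℂ^q`, so `X B = 0`, and `B` has a right inverse
(`sylvesterBijective_of_noKernelChain`).

*Square coefficients with regular pencils.* A common eigenvalue gives a rank one solution of
`A X B = C X D`. Conversely, for `A - t C` invertible, the space of solutions is stable under
`X ↦ (A - t C)⁻¹ C X`, and an eigenvector of this map exhibits a common eigenvalue
(`sylvesterBijective_of_det_pencil_ne_zero`).
-/

namespace GenSylvester

open Polynomial Matrix

variable {p m n q : ℕ}

/-! ### Kernel chains of a pencil -/

/-- A kernel chain of length `L` of the pair `(A, C)`: the coefficient sequence of a polynomial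
vector `f(λ)` of degree less than `L` with `(A + λ C) f(λ) = 0`. It is indexed by all of `ℕ`, and
vanishes from `L` on, so that shifting needs no bounds. -/
structure IsKernelChain {p m : ℕ} (A C : Matrix (Fin p) (Fin m) ℂ) (L : ℕ)
    (f : ℕ → Fin m → ℂ) : Prop where
  zero : A *ᵥ f 0 = 0
  succ : ∀ k, A *ᵥ f (k + 1) + C *ᵥ f k = 0
  vanish : ∀ k, L ≤ k → f k = 0

/-- The pair `(A, C)` has no nonzero kernel chain of length `L`. -/
def NoKernelChain {p m : ℕ} (A C : Matrix (Fin p) (Fin m) ℂ) (L : ℕ) : Prop :=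
  ∀ f, IsKernelChain A C L f → f = 0


lemma IsKernelChain.smul {A C : Matrix (Fin p) (Fin m) ℂ} {L : ℕ} {f : ℕ → Fin m → ℂ}
    (hf : IsKernelChain A C L f) (c : ℂ) : IsKernelChain A C L (c • f) where
  zero := by simp [mulVec_smul, hf.zero]
  succ k := by simp [mulVec_smul, ← smul_add, hf.succ]
  vanish k hk := by simp [hf.vanish k hk]

lemma IsKernelChain.shorten {A C : Matrix (Fin p) (Fin m) ℂ} {L : ℕ} {f : ℕ → Fin m → ℂ}
    (hf : IsKernelChain A C (L + 1) f) (h : f L = 0) : IsKernelChain A C L f where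
  zero := hf.zero
  succ := hf.succ
  vanish k hk := by
    rcases hk.eq_or_lt with rfl | hk
    · exact h
    · exact hf.vanish k hk

lemma noKernelChain_zero (A C : Matrix (Fin p) (Fin m) ℂ) : NoKernelChain A C 0 :=
  fun _ hf => funext fun k => hf.vanish k k.zero_le

/-- Reading a chain backwards exchanges the two matrices. -/
lemma NoKernelChain.swap {A C : Matrix (Fin p) (Fin m) ℂ} {L : ℕ} (h : NoKernelChain A C L) :
    NoKernelChain C A L := by
  intro g hg
  let f : ℕ → Fin m → ℂ := fun k => if k < L then g (L - 1 - k) else 0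
  have hf : IsKernelChain A C L f := by
    refine ⟨?_, fun k => ?_, fun k hk => if_neg (by omega)⟩
    · rcases Nat.eq_zero_or_pos L with rfl | hL
      · simp [f]
      · have h1 := hg.succ (L - 1)
        rw [hg.vanish _ (by omega : L ≤ L - 1 + 1)] at h1
        simpa [f, hL] using h1
    · rcases lt_trichotomy (k + 1) L with hk | hk | hk
      · have h1 := hg.succ (L - 1 - (k + 1))
        rw [show L - 1 - (k + 1) + 1 = L - 1 - k by omega] at h1
        simpa [f, hk, show k < L by omega, add_comm] using h1
      · subst hk
        simpa [f] using hg.zero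
      · simp [f, show ¬ k + 1 < L by omega, show ¬ k < L by omega]
  have hf0 := h f hf
  funext k
  by_cases hk : k < L
  · have := congrFun hf0 (L - 1 - k)
    simpa [f, show L - 1 - k < L by omega, show L - 1 - (L - 1 - k) = k by omega] using this
  · exact hg.vanish k (by omega)

/-- A pair with a nonzero chain of some length has one of least length. -/
lemma exists_minimal_kernelChain {A C : Matrix (Fin p) (Fin m) ℂ}
    (h : ∃ L, ¬ NoKernelChain A C L) :
    ∃ L f, NoKernelChain A C L ∧ IsKernelChain A C (L + 1) f ∧ f ≠ 0 := by
  classical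
  obtain ⟨L, hL⟩ : ∃ L, Nat.find h = L + 1 := Nat.exists_eq_succ_of_ne_zero fun h0 =>
    Nat.find_spec h (h0 ▸ noKernelChain_zero A C)
  have hmin : NoKernelChain A C L := not_not.mp (Nat.find_min h (by omega))
  have hex := Nat.find_spec h
  rw [hL, NoKernelChain] at hex
  push Not at hex
  obtain ⟨f, hf, hf0⟩ := hex
  exact ⟨L, f, hmin, hf, hf0⟩

/-- The independence property of chains of minimal length `L + 1`: the diagonal entries `f j j` of
`L + 1` such chains have a nonzero sum unless all the chains vanish. With multiples `c j • f` of a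
single chain for `f j`, it says that the entries of `f` are linearly independent. -/
lemma NoKernelChain.eq_zero_of_sum_diagonal_eq_zero {A C : Matrix (Fin p) (Fin m) ℂ} {L : ℕ}
    (h : NoKernelChain A C L) (f : ℕ → ℕ → Fin m → ℂ) (hf : ∀ j, IsKernelChain A C (L + 1) (f j))
    (hsum : ∑ j ∈ Finset.range (L + 1), f j j = 0) : ∀ j ≤ L, f j = 0 := by
  -- The shifted sums vanish at `0`, so from `1` on they form a chain of length `L`.
  let v : ℕ → Fin m → ℂ := fun k => ∑ j ∈ Finset.range (L + 1), f j (j + k)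
  have hv0 : v 0 = 0 := by simpa [v] using hsum
  have hsucc : ∀ k, A *ᵥ v (k + 1) + C *ᵥ v k = 0 := fun k => by
    simp only [v, mulVec_sum, ← Finset.sum_add_distrib]
    exact Finset.sum_eq_zero fun j _ => (hf j).succ (j + k)
  have hv : ∀ k, v (k + 1) = 0 := by
    refine fun k => congrFun (h (fun k => v (k + 1)) ⟨?_, fun k => hsucc _, fun k hk => ?_⟩) k
    · simpa [hv0] using hsucc 0
    · exact Finset.sum_eq_zero fun j _ => (hf j).vanish _ (by omega)
  have hv' : ∀ k, v k = 0 := fun k => by cases k <;> simp [hv0, hv]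
  intro i
  induction i using Nat.strong_induction_on with
  | _ i ih =>
    intro hi
    refine h _ ((hf i).shorten ?_)
    -- In `v (L - i)` the chains before `i` are already zero, and those after `i` have ended.
    have h1 := hv' (L - i)
    simp only [v] at h1
    rw [Finset.sum_eq_single i, show i + (L - i) = L by omega] at h1
    · exact h1
    · intro j _ hji
      rcases lt_or_gt_of_ne hji with hlt | hgt
      · rw [ih j hlt (by omega)]; rfl
      · exact (hf j).vanish _ (by omega)
    · simp [hi]

/-! ### The block bidiagonal matrix -/

/-- The `k`-th block of a block vector with `L` blocks, and zero for `k ≥ L`. -/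
def blockAt {L m : ℕ} (v : Fin L × Fin m → ℂ) (k : ℕ) : Fin m → ℂ :=
  fun b => if h : k < L then v (⟨k, h⟩, b) else 0

lemma blockAt_val {L m : ℕ} (v : Fin L × Fin m → ℂ) (j : Fin L) (b : Fin m) :
    blockAt v j b = v (j, b) := by
  simp [blockAt]

lemma blockAt_of_le {L m : ℕ} (v : Fin L × Fin m → ℂ) {k : ℕ} (h : L ≤ k) :
    blockAt v k = 0 := by
  funext b
  simp [blockAt, h]

lemma blockAt_eq_zero_iff {L m : ℕ} (v : Fin L × Fin m → ℂ) : blockAt v = 0 ↔ v = 0 := by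
  refine ⟨fun h => funext fun ⟨j, b⟩ => ?_, fun h => ?_⟩
  · rw [← blockAt_val v, h]; rfl
  · funext k b
    simp [blockAt, h]

lemma blockBidiag_apply {a b s : ℕ} (M N : Matrix (Fin a) (Fin b) ℂ) (i : Fin (s + 1) × Fin a)
    (j : Fin s × Fin b) : blockBidiag s M N i j =
      (if (j.1 : ℕ) = i.1 then M i.2 j.2 else 0) +
        (if (j.1 : ℕ) + 1 = i.1 then N i.2 j.2 else 0) := by
  simp only [blockBidiag, of_apply, Fin.ext_iff, Fin.val_castSucc, Fin.val_succ]
  split_ifs <;> first | omega | simp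

lemma blockBidiag_mulVec_zero {L : ℕ} (A C : Matrix (Fin p) (Fin m) ℂ) (v : Fin L × Fin m → ℂ)
    (a : Fin p) : (blockBidiag L A C *ᵥ v) (0, a) = (A *ᵥ blockAt v 0) a := by
  simp only [mulVec, dotProduct, Fintype.sum_prod_type, blockBidiag_apply, ← blockAt_val v]
  rw [Fin.sum_univ_eq_sum_range
      (fun j => ∑ b, ((if j = ((0 : Fin (L + 1)) : ℕ) then A a b else 0) +
        if j + 1 = ((0 : Fin (L + 1)) : ℕ) then C a b else 0) * blockAt v j b) L,
    Finset.sum_eq_single 0]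
  · simp
  · intro j _ hj; simp [hj]
  · intro h
    simp [blockAt_of_le v (show L ≤ 0 by simpa using h)]

lemma blockBidiag_mulVec_succ {L : ℕ} (A C : Matrix (Fin p) (Fin m) ℂ) (v : Fin L × Fin m → ℂ)
    (k : Fin L) (a : Fin p) : (blockBidiag L A C *ᵥ v) (k.succ, a) =
      (A *ᵥ blockAt v (k + 1) + C *ᵥ blockAt v k) a := by
  simp only [mulVec, dotProduct, Fintype.sum_prod_type, blockBidiag_apply, ← blockAt_val v,
    Pi.add_apply, add_mul, Finset.sum_add_distrib, Fin.val_succ]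
  rw [Fin.sum_univ_eq_sum_range
      (fun j => ∑ b, (if j = (k : ℕ) + 1 then A a b else 0) * blockAt v j b) L,
    Fin.sum_univ_eq_sum_range
      (fun j => ∑ b, (if j + 1 = (k : ℕ) + 1 then C a b else 0) * blockAt v j b) L,
    Finset.sum_eq_single ((k : ℕ) + 1), Finset.sum_eq_single (k : ℕ)]
  · simp
  · intro j _ hj; simp [hj]
  · intro h; simp at h
  · intro j _ hj; simp [hj]
  · intro h
    simp [blockAt_of_le v (show L ≤ (k : ℕ) + 1 by simpa using h)]

/-- The kernel of `blockBidiag L A C` consists of the kernel chains of length `L`. -/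
lemma blockBidiag_mulVec_eq_zero_iff {L : ℕ} (A C : Matrix (Fin p) (Fin m) ℂ)
    (v : Fin L × Fin m → ℂ) :
    blockBidiag L A C *ᵥ v = 0 ↔ IsKernelChain A C L (blockAt v) := by
  constructor
  · intro h
    refine ⟨funext fun a => ?_, fun k => ?_, fun k hk => blockAt_of_le v hk⟩
    · rw [← blockBidiag_mulVec_zero, h]; rfl
    · by_cases hk : k < L
      · funext a
        rw [← blockBidiag_mulVec_succ A C v ⟨k, hk⟩ a, h]; rfl
      · rw [blockAt_of_le v (by omega), blockAt_of_le v (by omega)]; simp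
  · intro h
    funext ⟨i, a⟩
    refine Fin.cases ?_ (fun k => ?_) i
    · rw [blockBidiag_mulVec_zero, h.zero]; rfl
    · rw [blockBidiag_mulVec_succ, h.succ]; rfl

lemma blockBidiag_vecMul_apply {L : ℕ} (B D : Matrix (Fin n) (Fin q) ℂ)
    (y : Fin (L + 1) × Fin n → ℂ) (k : Fin L) (b : Fin q) :
    (y ᵥ* blockBidiag L B D) (k, b) =
      (blockAt y (k + 1) ᵥ* D + blockAt y k ᵥ* B) b := by
  simp only [vecMul, dotProduct, Fintype.sum_prod_type, blockBidiag_apply, ← blockAt_val y,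
    Pi.add_apply, mul_add, Finset.sum_add_distrib]
  rw [Fin.sum_univ_eq_sum_range
      (fun i => ∑ a, blockAt y i a * (if (k : ℕ) = i then B a b else 0)) (L + 1),
    Fin.sum_univ_eq_sum_range
      (fun i => ∑ a, blockAt y i a * (if (k : ℕ) + 1 = i then D a b else 0)) (L + 1),
    Finset.sum_eq_single ((k : ℕ)), Finset.sum_eq_single ((k : ℕ) + 1)]
  · simp [add_comm]
  · intro j _ hj; simp [hj.symm]
  · intro h; simp at h
  · intro j _ hj; simp [hj.symm]
  · intro h; simp at h

lemma noKernelChain_iff {L : ℕ} (A C : Matrix (Fin p) (Fin m) ℂ) :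
    NoKernelChain A C L ↔ LinearMap.ker (blockBidiag L A C).mulVecLin = ⊥ := by
  rw [LinearMap.ker_eq_bot']
  simp only [mulVecLin_apply, blockBidiag_mulVec_eq_zero_iff]
  refine ⟨fun h v hv => (blockAt_eq_zero_iff v).1 (h _ hv), fun h f hf => ?_⟩
  have hfv : f = blockAt (fun jb : Fin L × Fin m => f jb.1 jb.2) := by
    funext k b
    by_cases hk : k < L
    · simp [blockAt, hk]
    · rw [hf.vanish k (by omega), blockAt_of_le _ (by omega)]
  rw [hfv] at hf ⊢
  exact (blockAt_eq_zero_iff _).2 (h _ hf)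

lemma NoKernelChain.mul_le {A C : Matrix (Fin p) (Fin m) ℂ} {L : ℕ} (h : NoKernelChain A C L) :
    L * m ≤ (L + 1) * p := by
  have := LinearMap.finrank_le_finrank_of_injective
    (LinearMap.ker_eq_bot.1 ((noKernelChain_iff A C).1 h))
  simpa using this

lemma isSquareInvertible_blockBidiag_iff {A C : Matrix (Fin p) (Fin m) ℂ} {L : ℕ} :
    IsSquareInvertible (blockBidiag L A C) ↔ L * m = (L + 1) * p ∧ NoKernelChain A C L := by
  rw [noKernelChain_iff, IsSquareInvertible]
  simp only [Fintype.card_prod, Fintype.card_fin]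
  refine ⟨fun ⟨hc, N, _, hN⟩ => ⟨hc.symm, ?_⟩, fun ⟨hc, hker⟩ => ⟨hc.symm, ?_⟩⟩
  · rw [LinearMap.ker_eq_bot']
    intro v hv
    have := congrArg (N *ᵥ ·) hv
    simpa [hN] using this
  · let e := LinearMap.linearEquivOfInjective _ (LinearMap.ker_eq_bot.1 hker) (by simp [hc])
    have he : ∀ v, e v = blockBidiag L A C *ᵥ v := fun v => rfl
    refine ⟨LinearMap.toMatrix' (e.symm : _ →ₗ[ℂ] _), ?_, ?_⟩
    · apply Matrix.toLin'.injective
      ext1 i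
      ext1
      simp [← he]
    · apply Matrix.toLin'.injective
      ext1 i
      ext1
      simp [← he]

/-! ### The generalized Sylvester operator and its symmetries -/

/-- The operator `X ↦ A X B - C X D`. -/
def sylvesterMap (A C : Matrix (Fin p) (Fin m) ℂ) (B D : Matrix (Fin n) (Fin q) ℂ) :
    Matrix (Fin m) (Fin n) ℂ →ₗ[ℂ] Matrix (Fin p) (Fin q) ℂ where
  toFun X := A * X * B - C * X * D
  map_add' X Y := by simp only [Matrix.mul_add, Matrix.add_mul]; abel
  map_smul' c X := by simp [smul_sub]

@[simp]
lemma sylvesterMap_apply (A C : Matrix (Fin p) (Fin m) ℂ) (B D : Matrix (Fin n) (Fin q) ℂ)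
    (X : Matrix (Fin m) (Fin n) ℂ) : sylvesterMap A C B D X = A * X * B - C * X * D := rfl

/-- The operator `X ↦ A X B - C X D` is nonsingular. -/
def SylvesterBijective (A C : Matrix (Fin p) (Fin m) ℂ) (B D : Matrix (Fin n) (Fin q) ℂ) : Prop :=
  Function.Bijective (sylvesterMap A C B D)

section

variable {A C : Matrix (Fin p) (Fin m) ℂ} {B D : Matrix (Fin n) (Fin q) ℂ}

lemma SylvesterBijective.eq_zero (h : SylvesterBijective A C B D) {X : Matrix (Fin m) (Fin n) ℂ}
    (hX : A * X * B = C * X * D) : X = 0 :=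
  h.1 (by simp [hX])

lemma SylvesterBijective.mul_eq_mul (h : SylvesterBijective A C B D) : m * n = p * q := by
  simpa [Module.finrank_matrix] using (LinearEquiv.ofBijective _ h).finrank_eq

lemma sylvesterBijective_of_forall_eq_zero (hdim : m * n = p * q)
    (h : ∀ X : Matrix (Fin m) (Fin n) ℂ, A * X * B = C * X * D → X = 0) :
    SylvesterBijective A C B D := by
  have hinj : Function.Injective (sylvesterMap A C B D) := by
    rw [← LinearMap.ker_eq_bot, LinearMap.ker_eq_bot']
    exact fun X hX => h X (sub_eq_zero.1 hX)
  exact ⟨hinj, (LinearMap.injective_iff_surjective_of_finrank_eq_finrank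
    (by simpa [Module.finrank_matrix] using hdim)).1 hinj⟩

/-- The operators of `(A, C; B, D)` and `(B, D; A, C)` are adjoint for the trace pairing. -/
lemma SylvesterBijective.swap (h : SylvesterBijective A C B D) : SylvesterBijective B D A C := by
  refine sylvesterBijective_of_forall_eq_zero (by rw [mul_comm, ← h.mul_eq_mul, mul_comm])
    fun Z hZ => ?_
  rw [Matrix.ext_iff_trace_mul_right]
  intro E
  obtain ⟨X, rfl⟩ := h.2 E
  have h1 : (Z * (A * X * B)).trace = (B * Z * A * X).trace := by
    rw [← Matrix.mul_assoc, Matrix.trace_mul_comm]; simp only [Matrix.mul_assoc]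
  have h2 : (Z * (C * X * D)).trace = (D * Z * C * X).trace := by
    rw [← Matrix.mul_assoc, Matrix.trace_mul_comm]; simp only [Matrix.mul_assoc]
  rw [sylvesterMap_apply, Matrix.mul_sub, Matrix.trace_sub, h1, h2, hZ]
  simp

lemma SylvesterBijective.neg (h : SylvesterBijective A C B D) : SylvesterBijective C A D B :=
  sylvesterBijective_of_forall_eq_zero h.mul_eq_mul fun _ hX => h.eq_zero hX.symm

lemma SylvesterBijective.transpose (h : SylvesterBijective A C B D) :
    SylvesterBijective Aᵀ Cᵀ Bᵀ Dᵀ := by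
  have h' := h.swap
  refine sylvesterBijective_of_forall_eq_zero h.mul_eq_mul.symm fun Z hZ => ?_
  rw [← Matrix.transpose_eq_zero]
  refine h'.eq_zero ?_
  simpa [Matrix.mul_assoc] using congrArg Matrix.transpose hZ

/-! ### Chains and the kernel of the operator -/

/-- A nonzero chain `f` of minimal length `L + 1` for `(A, C)` and a nonzero left null vector `y` of
`blockBidiag L B D` give the nonzero solution `X = ∑ j, f j * (y (L - j))ᵀ` of `A X B = C X D`.
So if the operator is injective, `blockBidiag L B D` has at least as many columns as rows. -/
lemma SylvesterBijective.le_mul_of_kernelChain (h : SylvesterBijective A C B D) {L : ℕ}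
    (hmin : NoKernelChain A C L) {f : ℕ → Fin m → ℂ} (hf : IsKernelChain A C (L + 1) f)
    (hf0 : f ≠ 0) : (L + 1) * n ≤ L * q := by
  by_contra! hlt
  obtain ⟨y, hy0, hy⟩ : ∃ y ≠ 0, y ᵥ* blockBidiag L B D = 0 := by
    have := LinearMap.ker_ne_bot_of_finrank_lt (f := (blockBidiag L B D).vecMulLinear)
      (by simpa using hlt)
    obtain ⟨y, hy, hy0⟩ := (Submodule.ne_bot_iff _).1 this
    exact ⟨y, hy0, hy⟩
  let z : ℕ → Fin n → ℂ := fun j => blockAt y (L - j)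
  have hz : ∀ j < L, z (j + 1) ᵥ* B + z j ᵥ* D = 0 := fun j hj => by
    funext b
    have h1 := blockBidiag_vecMul_apply B D y ⟨L - (j + 1), by omega⟩ b
    simp only [hy, show L - (j + 1) + 1 = L - j by omega] at h1
    rw [add_comm]
    exact h1.symm
  let X : Matrix (Fin m) (Fin n) ℂ := ∑ j ∈ Finset.range (L + 1), vecMulVec (f j) (z j)
  have hAX : A * X * B =
      -∑ j ∈ Finset.range L, vecMulVec (C *ᵥ f j) (z (j + 1) ᵥ* B) := by
    simp only [X, Matrix.mul_sum, Matrix.sum_mul, mul_vecMulVec, vecMulVec_mul]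
    rw [Finset.sum_range_succ', hf.zero, zero_vecMulVec, add_zero, ← Finset.sum_neg_distrib]
    refine Finset.sum_congr rfl fun j _ => ?_
    rw [eq_neg_of_add_eq_zero_left (hf.succ j), neg_vecMulVec]
  have hCX : C * X * D = ∑ j ∈ Finset.range L, vecMulVec (C *ᵥ f j) (z j ᵥ* D) := by
    have hCf : C *ᵥ f L = 0 := by
      simpa [hf.vanish (L + 1) le_rfl] using hf.succ L
    simp only [X, Matrix.mul_sum, Matrix.sum_mul, mul_vecMulVec, vecMulVec_mul]
    rw [Finset.sum_range_succ, hCf, zero_vecMulVec, add_zero]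
  have hX : X = 0 := by
    refine h.eq_zero ?_
    rw [hAX, hCX, ← Finset.sum_neg_distrib]
    refine Finset.sum_congr rfl fun j hj => ?_
    rw [eq_neg_of_add_eq_zero_left (hz j (Finset.mem_range.1 hj)), vecMulVec_neg, neg_neg]
  -- A column of `X` where `y` is nonzero is a linear relation between the entries of `f`.
  refine hy0 (funext fun ⟨i, c⟩ => ?_)
  have hrel : ∑ j ∈ Finset.range (L + 1), z j c • f j = 0 := by
    funext b
    have h1 := congrFun (congrFun hX b) c
    simpa [X, Matrix.sum_apply, vecMulVec_apply, mul_comm] using h1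
  have h2 := hmin.eq_zero_of_sum_diagonal_eq_zero (fun j => z j c • f) (fun j => hf.smul _)
    hrel (L - i) (Nat.sub_le _ _)
  have h3 := (smul_eq_zero.1 h2).resolve_right hf0
  have hi : L - (L - (i : ℕ)) = i := by omega
  simpa [z, hi, blockAt_val] using h3

/-- If both block matrices are square and have trivial kernel, the operator is bijective: for a
solution of `A X B = C X D` and a chain `u` of `(B, D)`, the vectors `X B u j` form a chain of
`(C, A)` shorter than allowed, and the chains of `(B, D)` span `ℂ^q`. -/
lemma sylvesterBijective_of_noKernelChain {s : ℕ} (hdim : m * n = p * q)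
    (hBD : s * q = (s + 1) * n) (hA : NoKernelChain A C s)
    (hB : IsSquareInvertible (blockBidiag s B D)) (hs : 0 < s) : SylvesterBijective A C B D := by
  refine sylvesterBijective_of_forall_eq_zero hdim fun X hX => ?_
  have hBker := (isSquareInvertible_blockBidiag_iff.1 hB).2
  have hchain : ∀ u, IsKernelChain B D (s + 1) u → ∀ j, (X * B) *ᵥ u j = 0 := by
    intro u hu
    have h0 : (X * B) *ᵥ u 0 = 0 := by rw [← mulVec_mulVec, hu.zero, mulVec_zero]
    have hsucc : ∀ j, C *ᵥ ((X * B) *ᵥ u (j + 1)) + A *ᵥ ((X * B) *ᵥ u j) = 0 := fun j => by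
      have h1 : C *ᵥ ((X * B) *ᵥ u (j + 1)) = -((C * X * D) *ᵥ u j) := by
        rw [← mulVec_mulVec, eq_neg_of_add_eq_zero_left (hu.succ j), mulVec_neg, mulVec_neg]
        simp only [mulVec_mulVec, Matrix.mul_assoc]
      rw [h1, ← hX]
      simp only [mulVec_mulVec, Matrix.mul_assoc, neg_add_cancel]
    have h1 := hA.swap (fun j => (X * B) *ᵥ u (j + 1))
      ⟨by simpa [h0] using hsucc 0, fun k => hsucc _, fun k hk => by
        rw [hu.vanish _ (by omega), mulVec_zero]⟩
    exact fun j => by cases j with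
      | zero => exact h0
      | succ j => exact congrFun h1 j
  -- The diagonal sums of `s + 1` chains of length `s + 1` fill `ℂ^q`, by a dimension count.
  let K := LinearMap.ker (blockBidiag (s + 1) B D).mulVecLin
  let Θ : (Fin (s + 1) → K) →ₗ[ℂ] (Fin q → ℂ) :=
    ∑ j : Fin (s + 1), LinearMap.funLeft ℂ ℂ (fun b => (j, b)) ∘ₗ K.subtype ∘ₗ LinearMap.proj j
  have hΘ : ∀ F, Θ F = ∑ j ∈ Finset.range (s + 1),
      if hj : j < s + 1 then blockAt (F ⟨j, hj⟩ : Fin (s + 1) × Fin q → ℂ) j else 0 := by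
    intro F
    rw [← Fin.sum_univ_eq_sum_range (fun j =>
      if hj : j < s + 1 then blockAt (F ⟨j, hj⟩ : Fin (s + 1) × Fin q → ℂ) j else 0)]
    funext b
    simp only [Θ, LinearMap.sum_apply, Finset.sum_apply, LinearMap.comp_apply, LinearMap.proj_apply,
      LinearMap.funLeft_apply, Submodule.subtype_apply]
    refine Finset.sum_congr rfl fun j _ => ?_
    rw [dif_pos j.2, blockAt_val]
  have hK : ∀ w : K, IsKernelChain B D (s + 1) (blockAt (w : Fin (s + 1) × Fin q → ℂ)) :=
    fun w => (blockBidiag_mulVec_eq_zero_iff B D _).1 w.2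
  have hΘinj : Function.Injective Θ := by
    rw [← LinearMap.ker_eq_bot, LinearMap.ker_eq_bot']
    intro F hF
    have h1 := hBker.eq_zero_of_sum_diagonal_eq_zero
      (fun j => if hj : j < s + 1 then blockAt (F ⟨j, hj⟩ : Fin (s + 1) × Fin q → ℂ) else 0)
      (fun j => by
        split_ifs with hj
        · exact hK _
        · exact ⟨by simp, by simp, by simp⟩)
      (by
        rw [← hF, hΘ]
        refine Finset.sum_congr rfl fun j hj => ?_
        simp [Finset.mem_range.1 hj])
    funext j
    have h2 := h1 j (by omega)
    rw [dif_pos j.2, blockAt_eq_zero_iff] at h2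
    exact Subtype.ext h2
  have hKdim : (s + 1) * q ≤ (s + 1 + 1) * n + Module.finrank ℂ K := by
    have h1 := LinearMap.finrank_range_add_finrank_ker (blockBidiag (s + 1) B D).mulVecLin
    have h2 := Submodule.finrank_le (LinearMap.range (blockBidiag (s + 1) B D).mulVecLin)
    simp only [Module.finrank_fintype_fun_eq_card, Fintype.card_prod, Fintype.card_fin] at h1 h2
    change _ + Module.finrank ℂ K = _ at h1
    omega
  have hΘdim : Module.finrank ℂ (Fin (s + 1) → K) = Module.finrank ℂ (Fin q → ℂ) := by
    refine le_antisymm (LinearMap.finrank_le_finrank_of_injective hΘinj) ?_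
    simp only [Module.finrank_pi_fintype, Finset.sum_const, Finset.card_univ, Fintype.card_fin,
      smul_eq_mul, Module.finrank_self, mul_one]
    nlinarith
  have hXB : X * B = 0 := by
    refine Matrix.toLin'.injective (LinearMap.ext fun u => ?_)
    obtain ⟨F, rfl⟩ := (LinearMap.injective_iff_surjective_of_finrank_eq_finrank hΘdim).1 hΘinj u
    rw [hΘ, toLin'_apply, mulVec_sum, map_zero, LinearMap.zero_apply]
    refine Finset.sum_eq_zero fun j hj => ?_
    rw [dif_pos (Finset.mem_range.1 hj)]
    exact hchain _ (hK _) j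
  -- `B` is right invertible, by the first block row of the inverse.
  obtain ⟨_, N, hN, -⟩ := hB
  have hBN : B * Matrix.of (fun b c => N (⟨0, hs⟩, b) (0, c)) = 1 := by
    ext a c
    have h1 := congrFun (congrFun hN (0, a)) (0, c)
    have h2 := blockBidiag_mulVec_zero B D (fun i => N i (0, c)) a
    rw [show blockAt (fun i => N i (0, c)) 0 = fun b => N (⟨0, hs⟩, b) (0, c) by
      funext b; simp [blockAt, hs]] at h2
    refine (h2.symm.trans h1).trans ?_
    simp [Matrix.one_apply]
  rw [← Matrix.mul_one X, ← hBN, ← Matrix.mul_assoc, hXB, Matrix.zero_mul]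

end

/-! ### Square pencils -/

lemma pencil_eq (A C : Matrix (Fin p) (Fin p) ℂ) :
    pencil A C = (X : ℂ[X]) • (-C).map Polynomial.C + A.map Polynomial.C := by
  ext i j
  simp [pencil]
  ring

lemma eval_det_pencil (A C : Matrix (Fin p) (Fin p) ℂ) (z : ℂ) :
    (pencil A C).det.eval z = (A - z • C).det := by
  rw [← coe_evalRingHom, RingHom.map_det]
  congr 1
  ext i j
  simp [pencil]
  ring

lemma degree_det_pencil_lt_iff (A C : Matrix (Fin p) (Fin p) ℂ) :
    (pencil A C).det.degree < (p : WithBot ℕ) ↔ C.det = 0 := by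
  have hle : (pencil A C).det.natDegree ≤ p := by
    simpa [pencil_eq] using natDegree_det_X_add_C_le (-C) A
  have hcoeff : (pencil A C).det.coeff p = (-1) ^ p * C.det := by
    have := coeff_det_X_add_C_card (-C) A
    rw [← pencil_eq, det_neg, Fintype.card_fin] at this
    exact this
  have hiff : C.det = 0 ↔ (pencil A C).det.coeff p = 0 := by simp [hcoeff]
  rw [hiff]
  refine ⟨coeff_eq_zero_of_degree_lt, fun h => (degree_lt_iff_coeff_zero _ _).2 fun k hk => ?_⟩
  rcases hk.eq_or_lt with rfl | hk
  · exact h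
  · exact coeff_eq_zero_of_natDegree_lt (hle.trans_lt hk)

lemma det_pencil_transpose (A C : Matrix (Fin p) (Fin p) ℂ) :
    (pencil Aᵀ Cᵀ).det = (pencil A C).det := by
  rw [← det_transpose]
  rfl

lemma isRegularPencil_iff (A C : Matrix (Fin p) (Fin p) ℂ) :
    IsRegularPencil (pencil A C) ↔ (pencil A C).det ≠ 0 :=
  ⟨fun ⟨_, h⟩ => h, fun h => ⟨rfl, h⟩⟩

lemma coe_mem_pencilSpectrum_iff {A C : Matrix (Fin p) (Fin p) ℂ} (h : (pencil A C).det ≠ 0)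
    (z : ℂ) : (z : OnePoint ℂ) ∈ pencilSpectrum (pencil A C) ↔ (A - z • C).det = 0 := by
  rw [← eval_det_pencil]
  constructor
  · rintro ⟨_, _, ⟨w, hw, hroot⟩ | ⟨hw, _⟩⟩
    · rw [OnePoint.coe_injective hw]; exact hroot
    · exact absurd hw (OnePoint.coe_ne_infty z)
  · exact fun hz => ⟨rfl, h, Or.inl ⟨z, rfl, hz⟩⟩

lemma infty_mem_pencilSpectrum_iff {A C : Matrix (Fin p) (Fin p) ℂ} (h : (pencil A C).det ≠ 0) :
    OnePoint.infty ∈ pencilSpectrum (pencil A C) ↔ C.det = 0 := by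
  rw [← degree_det_pencil_lt_iff A C]
  constructor
  · rintro ⟨_, _, ⟨w, hw, _⟩ | ⟨_, hdeg⟩⟩
    · exact absurd hw.symm (OnePoint.coe_ne_infty w)
    · exact hdeg
  · exact fun hdeg => ⟨rfl, h, Or.inr ⟨rfl, hdeg⟩⟩

/-- A singular square pencil has a nonzero polynomial null vector. The coefficients need alternating
signs, since chains are formed with `A + λ C`. -/
lemma exists_not_noKernelChain_of_det_pencil_eq_zero {A C : Matrix (Fin p) (Fin p) ℂ}
    (h : (pencil A C).det = 0) : ∃ L, ¬ NoKernelChain A C L := by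
  obtain ⟨v, hv0, hv⟩ := exists_mulVec_eq_zero_iff.2 h
  let f : ℕ → Fin p → ℂ := fun k b => (-1) ^ k * (v b).coeff k
  have hcoeff : ∀ k a, ∑ b, (A a b * (v b).coeff k - C a b * (X * v b).coeff k) = 0 := by
    intro k a
    have h1 := congrArg (fun r => Polynomial.coeff r k) (congrFun hv a)
    simp only [mulVec, dotProduct, pencil, Matrix.sub_apply, Matrix.smul_apply, map_apply,
      smul_eq_mul, sub_mul, finsetSum_coeff, coeff_sub, Pi.zero_apply, coeff_zero,
      coeff_C_mul] at h1
    rw [← h1]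
    refine Finset.sum_congr rfl fun b _ => ?_
    rw [mul_comm X (Polynomial.C _), mul_assoc, coeff_C_mul]
  refine ⟨(Finset.univ.sup fun b => (v b).natDegree) + 1, fun hL => hv0 ?_⟩
  have hf : f = 0 := by
    refine hL f ⟨?_, fun k => ?_, fun k hk => ?_⟩
    · funext a
      simpa [f, mulVec, dotProduct] using hcoeff 0 a
    · funext a
      have h1 := hcoeff (k + 1) a
      simp only [coeff_X_mul] at h1
      simp only [f, Pi.add_apply, mulVec, dotProduct, ← Finset.sum_add_distrib, Pi.zero_apply]
      rw [← mul_zero ((-1 : ℂ) ^ (k + 1)), ← h1, Finset.mul_sum]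
      refine Finset.sum_congr rfl fun b _ => ?_
      ring
    · funext b
      have h1 : (v b).natDegree ≤ Finset.univ.sup fun b => (v b).natDegree :=
        Finset.le_sup (f := fun b => (v b).natDegree) (Finset.mem_univ b)
      simp [f, coeff_eq_zero_of_natDegree_lt (show (v b).natDegree < k by omega)]
  funext b
  ext k
  have h1 := congrFun (congrFun hf k) b
  simpa [f] using h1

section

variable {A C : Matrix (Fin p) (Fin p) ℂ} {B D : Matrix (Fin n) (Fin n) ℂ}

lemma SylvesterBijective.det_pencil_ne_zero (h : SylvesterBijective A C B D) (hn : 0 < n) :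
    (pencil A C).det ≠ 0 := by
  intro h0
  obtain ⟨L, f, hmin, hf, hf0⟩ :=
    exists_minimal_kernelChain (exists_not_noKernelChain_of_det_pencil_eq_zero h0)
  have := h.le_mul_of_kernelChain hmin hf hf0
  nlinarith

lemma eq_zero_or_eq_zero_of_vecMulVec_eq_zero {x : Fin p → ℂ} {y : Fin n → ℂ}
    (h : vecMulVec x y = 0) :
    x = 0 ∨ y = 0 := by
  by_contra! hxy
  obtain ⟨i, hi⟩ := Function.ne_iff.1 hxy.1
  obtain ⟨j, hj⟩ := Function.ne_iff.1 hxy.2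
  exact mul_ne_zero hi hj (congrFun (congrFun h i) j)

/-- Right null vectors `x` of `A - z C` and left null vectors `y` of `D - z B` give the
solution `x yᵀ` of `A X B = C X D`. -/
lemma SylvesterBijective.det_sub_ne_zero (h : SylvesterBijective A C B D) {z : ℂ}
    (hA : (A - z • C).det = 0) : (D - z • B).det ≠ 0 := by
  intro hD
  obtain ⟨x, hx0, hx⟩ := exists_mulVec_eq_zero_iff.2 hA
  obtain ⟨y, hy0, hy⟩ := exists_vecMul_eq_zero_iff.2 hD
  rw [sub_mulVec, sub_eq_zero, smul_mulVec] at hx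
  rw [vecMul_sub, sub_eq_zero, vecMul_smul] at hy
  have h1 : vecMulVec x y = 0 := h.eq_zero (by
    rw [mul_vecMulVec, mul_vecMulVec, vecMulVec_mul, vecMulVec_mul, hx, hy, smul_vecMulVec,
      vecMulVec_smul])
  exact (eq_zero_or_eq_zero_of_vecMulVec_eq_zero h1).elim hx0 hy0

lemma SylvesterBijective.det_ne_zero (h : SylvesterBijective A C B D) (hC : C.det = 0) :
    B.det ≠ 0 := by
  intro hB
  obtain ⟨x, hx0, hx⟩ := exists_mulVec_eq_zero_iff.2 hC
  obtain ⟨y, hy0, hy⟩ := exists_vecMul_eq_zero_iff.2 hB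
  have h1 : vecMulVec x y = 0 := h.eq_zero (by
    rw [mul_vecMulVec, mul_vecMulVec, vecMulVec_mul, vecMulVec_mul, hx, hy, zero_vecMulVec]
    ext
    simp [vecMulVec_apply])
  exact (eq_zero_or_eq_zero_of_vecMulVec_eq_zero h1).elim hx0 hy0

lemma det_eq_zero_of_mul_eq_zero {M : Matrix (Fin p) (Fin p) ℂ} {X : Matrix (Fin p) (Fin n) ℂ}
    (hX : X ≠ 0) (h : M * X = 0) : M.det = 0 := by
  by_contra hM
  refine hX ?_
  rw [← Matrix.one_mul X, ← nonsing_inv_mul M (isUnit_iff_ne_zero.2 hM), Matrix.mul_assoc, h,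
    Matrix.mul_zero]

lemma det_eq_zero_of_mul_eq_zero' {M : Matrix (Fin n) (Fin n) ℂ} {X : Matrix (Fin p) (Fin n) ℂ}
    (hX : X ≠ 0) (h : X * M = 0) : M.det = 0 := by
  rw [← det_transpose]
  exact det_eq_zero_of_mul_eq_zero (X := Xᵀ) (by simpa using hX)
    (by rw [← transpose_mul, h, transpose_zero])

/-- If `A - t C` is invertible, the solution space of `A X B = C X D` is stable under
`X ↦ (A - t C)⁻¹ C X`. An eigenvector of this map on a nonzero solution space shows that the two
pencils have a common eigenvalue. -/
lemma sylvesterBijective_of_det_pencil_ne_zero (hA : (pencil A C).det ≠ 0)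
    (hfin : ∀ z : ℂ, (A - z • C).det = 0 → (D - z • B).det ≠ 0)
    (hinf : C.det = 0 → B.det ≠ 0) : SylvesterBijective A C B D := by
  refine sylvesterBijective_of_forall_eq_zero rfl ?_
  by_contra! hne
  obtain ⟨X₀, hX₀, hX₀0⟩ := hne
  obtain ⟨t, ht⟩ : ∃ t, (A - t • C).det ≠ 0 := by
    by_contra! hall
    exact hA (Polynomial.funext fun t => by rw [eval_det_pencil, hall, eval_zero])
  set A' := A - t • C with hA'
  set D' := D - t • B with hD'
  have hinv : A' * A'⁻¹ = 1 := mul_nonsing_inv A' (isUnit_iff_ne_zero.2 ht)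
  have hinv' : A'⁻¹ * A' = 1 := nonsing_inv_mul A' (isUnit_iff_ne_zero.2 ht)
  have hshift : ∀ X : Matrix (Fin p) (Fin n) ℂ,
      A * X * B = C * X * D ↔ A' * X * B = C * X * D' := fun X => by
    simp only [hA', hD', Matrix.sub_mul, Matrix.mul_sub, Matrix.smul_mul, Matrix.mul_smul,
      sub_left_inj]
  let W := LinearMap.ker (sylvesterMap A' C B D')
  have hW : ∀ X, X ∈ W ↔ A' * X * B = C * X * D' := fun X => by
    rw [LinearMap.mem_ker, sylvesterMap_apply, sub_eq_zero]
  let S : Matrix (Fin p) (Fin n) ℂ →ₗ[ℂ] Matrix (Fin p) (Fin n) ℂ :=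
    mulLeftLinearMap (Fin n) ℂ (A'⁻¹ * C)
  have hS : ∀ X ∈ W, S X ∈ W := fun X hX => by
    rw [hW] at hX ⊢
    change A' * (A'⁻¹ * C * X) * B = C * (A'⁻¹ * C * X) * D'
    calc A' * (A'⁻¹ * C * X) * B = (A' * A'⁻¹) * (C * X * B) := by simp only [Matrix.mul_assoc]
      _ = C * (A'⁻¹ * A') * X * B := by rw [hinv, hinv']; simp
      _ = C * A'⁻¹ * (A' * X * B) := by simp only [Matrix.mul_assoc]
      _ = C * (A'⁻¹ * C * X) * D' := by rw [hX]; simp only [Matrix.mul_assoc]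
  have : Nontrivial W :=
    ⟨⟨⟨X₀, (hW _).2 ((hshift _).1 hX₀)⟩, 0, fun h => hX₀0 (congrArg Subtype.val h)⟩⟩
  obtain ⟨μ, hμ⟩ := Module.End.exists_eigenvalue (S.restrict hS)
  obtain ⟨⟨X, hXW⟩, hXS, hX0⟩ := hμ.exists_hasEigenvector
  replace hX0 : X ≠ 0 := fun h => hX0 (Subtype.ext h)
  replace hXS : A'⁻¹ * C * X = μ • X := congrArg Subtype.val (Module.End.mem_eigenspace_iff.1 hXS)
  rw [hW] at hXW
  have hCX : C * X = μ • (A' * X) := by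
    rw [← Matrix.mul_smul, ← hXS, Matrix.mul_assoc, ← Matrix.mul_assoc A', hinv, Matrix.one_mul]
  have hXB : X * B = μ • (X * D') := by
    calc X * B = A'⁻¹ * (A' * X * B) := by
          simp only [← Matrix.mul_assoc, hinv', Matrix.one_mul]
      _ = A'⁻¹ * C * X * D' := by rw [hXW]; simp only [Matrix.mul_assoc]
      _ = μ • (X * D') := by rw [hXS, Matrix.smul_mul]
  rcases eq_or_ne μ 0 with rfl | hμ0
  · rw [zero_smul] at hCX hXB
    exact hinf (det_eq_zero_of_mul_eq_zero hX0 hCX) (det_eq_zero_of_mul_eq_zero' hX0 hXB)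
  · -- `C X = μ (A - t C) X` means `A X = z C X` with `z = t + μ⁻¹`.
    have hAX : (A - (t + μ⁻¹) • C) * X = 0 := by
      rw [add_smul, ← sub_sub, Matrix.sub_mul, Matrix.smul_mul, hCX, smul_smul,
        inv_mul_cancel₀ hμ0, one_smul, sub_self]
    have hXD : X * (D - (t + μ⁻¹) • B) = 0 := by
      rw [add_smul, ← sub_sub, Matrix.mul_sub, Matrix.mul_smul, hXB, smul_smul,
        inv_mul_cancel₀ hμ0, one_smul, sub_self]
    exact hfin _ (det_eq_zero_of_mul_eq_zero hX0 hAX) (det_eq_zero_of_mul_eq_zero' hX0 hXD)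

/-- The criterion for square coefficients. -/
theorem sylvesterBijective_iff_of_square (hp : 0 < p) (hn : 0 < n) :
    SylvesterBijective A C B D ↔ IsRegularPencil (pencil A C) ∧ IsRegularPencil (pencil Dᵀ Bᵀ) ∧
      Disjoint (pencilSpectrum (pencil A C)) (pencilSpectrum (pencil Dᵀ Bᵀ)) := by
  have htr : ∀ z : ℂ, (Dᵀ - z • Bᵀ).det = (D - z • B).det := fun z => by
    rw [← transpose_smul, ← transpose_sub, det_transpose]
  constructor
  · intro h
    have hA := h.det_pencil_ne_zero hn
    have hD : (pencil Dᵀ Bᵀ).det ≠ 0 := by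
      rw [det_pencil_transpose]
      exact h.neg.swap.det_pencil_ne_zero hp
    refine ⟨(isRegularPencil_iff _ _).2 hA, (isRegularPencil_iff _ _).2 hD,
      Set.disjoint_left.2 fun μ => ?_⟩
    induction μ using OnePoint.rec with
    | infty =>
      rw [infty_mem_pencilSpectrum_iff hA, infty_mem_pencilSpectrum_iff hD, det_transpose]
      exact h.det_ne_zero
    | coe z =>
      rw [coe_mem_pencilSpectrum_iff hA, coe_mem_pencilSpectrum_iff hD, htr]
      exact h.det_sub_ne_zero
  · rintro ⟨hA, hD, hdisj⟩
    rw [isRegularPencil_iff] at hA hD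
    rw [Set.disjoint_left] at hdisj
    refine sylvesterBijective_of_det_pencil_ne_zero hA (fun z hz hz' => ?_) (fun hC hB => ?_)
    · exact hdisj ((coe_mem_pencilSpectrum_iff hA z).2 hz)
        ((coe_mem_pencilSpectrum_iff hD z).2 ((htr z).trans hz'))
    · exact hdisj ((infty_mem_pencilSpectrum_iff hA).2 hC)
        ((infty_mem_pencilSpectrum_iff hD).2 ((det_transpose B).trans hB))

end

/-! ### Pencils with fewer rows than columns -/

lemma exists_not_noKernelChain_of_lt (A C : Matrix (Fin p) (Fin m) ℂ) (hpm : p < m) :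
    ∃ L, ¬ NoKernelChain A C L :=
  ⟨p + 1, fun h => by nlinarith [h.mul_le]⟩

lemma lt_of_lt_of_mul_eq_mul (hn : 0 < n) (h : m * n = p * q) (hpm : p < m) : n < q := by
  nlinarith

/-- For a wide pencil the least length `L + 1` of a nonzero chain is determined by the sizes:
minimality gives `L m ≤ (L + 1) p`, injectivity of the operator gives `(L + 1) n ≤ L q`, and
`m n = p q` makes both equalities. -/
lemma SylvesterBijective.exists_isSquareInvertible {A C : Matrix (Fin p) (Fin m) ℂ}
    {B D : Matrix (Fin n) (Fin q) ℂ} (h : SylvesterBijective A C B D) (hp : 0 < p) (hn : 0 < n)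
    (hpm : p < m) : ∃ s : ℕ, 0 < s ∧ s * m = (s + 1) * p ∧ s * q = (s + 1) * n ∧
      IsSquareInvertible (blockBidiag s A C) := by
  obtain ⟨L, f, hmin, hf, hf0⟩ :=
    exists_minimal_kernelChain (exists_not_noKernelChain_of_lt A C hpm)
  have h1 := hmin.mul_le
  have h2 := h.le_mul_of_kernelChain hmin hf hf0
  have h3 := h.mul_eq_mul
  have hq : 0 < q := hn.trans (lt_of_lt_of_mul_eq_mul hn h3 hpm)
  have h4 : L * m = (L + 1) * p := by
    refine le_antisymm h1 (le_of_mul_le_mul_right ?_ hq)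
    calc (L + 1) * p * q = (L + 1) * n * m := by rw [mul_assoc, ← h3]; ring
      _ ≤ L * q * m := Nat.mul_le_mul_right _ h2
      _ = L * m * q := by ring
  have h5 : L * q = (L + 1) * n := by
    refine le_antisymm (le_of_mul_le_mul_right ?_ hp) h2
    calc L * q * p = L * m * n := by rw [mul_assoc, mul_comm q, ← h3]; ring
      _ = (L + 1) * p * n := by rw [h4]
      _ ≤ (L + 1) * n * p := by rw [mul_right_comm]
  refine ⟨L, Nat.pos_of_ne_zero ?_, h4, h5, isSquareInvertible_blockBidiag_iff.2 ⟨h4, hmin⟩⟩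
  rintro rfl
  omega

lemma natCast_eq_div_sub_iff {s a b : ℕ} (hab : a < b) :
    (s : ℚ) = (a : ℚ) / ((b : ℚ) - (a : ℚ)) ↔ s * b = (s + 1) * a := by
  have hab' : (b : ℚ) - a ≠ 0 := (sub_pos.2 (Nat.cast_lt.2 hab)).ne'
  rw [eq_div_iff hab', ← Nat.cast_inj (R := ℚ)]
  push_cast
  constructor <;> intro h <;> linarith

/-- The criterion for `A` and `C` with fewer rows than columns. -/
theorem sylvesterBijective_iff_of_lt {A C : Matrix (Fin p) (Fin m) ℂ}
    {B D : Matrix (Fin n) (Fin q) ℂ} (hp : 0 < p) (hn : 0 < n) (hpm : p < m) :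
    SylvesterBijective A C B D ↔ n < q ∧ ∃ s : ℕ, 0 < s ∧
      (s : ℚ) = (p : ℚ) / ((m : ℚ) - (p : ℚ)) ∧ (s : ℚ) = (n : ℚ) / ((q : ℚ) - (n : ℚ)) ∧
      IsSquareInvertible (blockBidiag s A C) ∧ IsSquareInvertible (blockBidiag s B D) := by
  constructor
  · intro h
    have hnq := lt_of_lt_of_mul_eq_mul hn h.mul_eq_mul hpm
    obtain ⟨s, hs, hsm, hsq, hA⟩ := h.exists_isSquareInvertible hp hn hpm
    obtain ⟨r, -, hrq, -, hB⟩ := h.swap.exists_isSquareInvertible hn hp hnq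
    obtain rfl : s = r := by
      have h1 := (natCast_eq_div_sub_iff hnq).2 hsq
      have h2 := (natCast_eq_div_sub_iff hnq).2 hrq
      exact_mod_cast h1.trans h2.symm
    exact ⟨hnq, s, hs, (natCast_eq_div_sub_iff hpm).2 hsm, (natCast_eq_div_sub_iff hnq).2 hsq,
      hA, hB⟩
  · rintro ⟨hnq, s, hs, hsm, hsq, hA, hB⟩
    rw [natCast_eq_div_sub_iff hpm] at hsm
    rw [natCast_eq_div_sub_iff hnq] at hsq
    refine sylvesterBijective_of_noKernelChain ?_ hsq
      (isSquareInvertible_blockBidiag_iff.1 hA).2 hB hs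
    refine Nat.eq_of_mul_eq_mul_left (Nat.mul_pos hs s.succ_pos) ?_
    calc s * (s + 1) * (m * n) = (s * m) * ((s + 1) * n) := by ring
      _ = s * (s + 1) * (p * q) := by rw [hsm, ← hsq]; ring

lemma existsUnique_iff_sylvesterBijective {A C : Matrix (Fin p) (Fin m) ℂ}
    {B D : Matrix (Fin n) (Fin q) ℂ} :
    (∀ E : Matrix (Fin p) (Fin q) ℂ,
      ∃! X : Matrix (Fin m) (Fin n) ℂ, A * X * B - C * X * D = E) ↔ SylvesterBijective A C B D :=
  (Function.bijective_iff_existsUnique _).symm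

end GenSylvester

theorem mainTheorem5 (p m n q : ℕ) (hp : 0 < p) (hm : 0 < m) (hn : 0 < n) (hq : 0 < q)
    (A C : Matrix (Fin p) (Fin m) ℂ) (B D : Matrix (Fin n) (Fin q) ℂ) :
    (∀ E : Matrix (Fin p) (Fin q) ℂ,
      ∃! X : Matrix (Fin m) (Fin n) ℂ, A * X * B - C * X * D = E) ↔
    ((p = m ∧ q = n ∧
        GenSylvester.IsRegularPencil (GenSylvester.pencil A C) ∧
        GenSylvester.IsRegularPencil (GenSylvester.pencil D.transpose B.transpose) ∧
        Disjoint (GenSylvester.pencilSpectrum (GenSylvester.pencil A C))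
          (GenSylvester.pencilSpectrum (GenSylvester.pencil D.transpose B.transpose))) ∨
      (p < m ∧ n < q ∧
        ∃ s : ℕ, 0 < s ∧
          (s : ℚ) = (p : ℚ) / ((m : ℚ) - (p : ℚ)) ∧
          (s : ℚ) = (n : ℚ) / ((q : ℚ) - (n : ℚ)) ∧
          GenSylvester.IsSquareInvertible (GenSylvester.blockBidiag s A C) ∧
          GenSylvester.IsSquareInvertible (GenSylvester.blockBidiag s B D)) ∨
      (m < p ∧ q < n ∧
        ∃ s : ℕ, 0 < s ∧
          (s : ℚ) = (m : ℚ) / ((p : ℚ) - (m : ℚ)) ∧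
          (s : ℚ) = (q : ℚ) / ((n : ℚ) - (q : ℚ)) ∧
          GenSylvester.IsSquareInvertible (GenSylvester.blockBidiag s A.transpose C.transpose) ∧
          GenSylvester.IsSquareInvertible
            (GenSylvester.blockBidiag s B.transpose D.transpose))) := by
  rw [GenSylvester.existsUnique_iff_sylvesterBijective]
  rcases lt_trichotomy p m with hpm | rfl | hpm
  · rw [GenSylvester.sylvesterBijective_iff_of_lt hp hn hpm]
    simp only [hpm, hpm.ne, not_lt.2 hpm.le, true_and, false_and, false_or, or_false]
  · simp only [lt_irrefl, true_and, false_and, or_false]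
    constructor
    · intro h
      obtain rfl : n = q := Nat.eq_of_mul_eq_mul_left hp h.mul_eq_mul
      exact ⟨rfl, (GenSylvester.sylvesterBijective_iff_of_square hp hn).1 h⟩
    · rintro ⟨rfl, h⟩
      exact (GenSylvester.sylvesterBijective_iff_of_square hp hn).2 h
  · have htr : GenSylvester.SylvesterBijective A C B D ↔
        GenSylvester.SylvesterBijective A.transpose C.transpose B.transpose D.transpose :=
      ⟨fun h => h.transpose, fun h => h.transpose⟩
    rw [htr, GenSylvester.sylvesterBijective_iff_of_lt hm hq hpm]
    simp only [hpm, hpm.ne', not_lt.2 hpm.le, true_and, false_and, false_or]
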